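/- Let $R$ be a w-local ring, i.e. a commutative ring such that every open cover $\{U_i\}$ of the spectral space $|\operatorname{Spec} R|$ splits (the map $\bigsqcup_i U_i \to |\operatorname{Spec} R|$ has a continuous section) and such that the set of closed points of $|\operatorname{Spec} R|$ is closed. Let $\pi_0\operatorname{Spec} R$ be the profinite set of connected components of $|\operatorname{Spec} R|$. For a compactly generated Hausdorff space $X$ equipped with a continuous map to $\pi_0\operatorname{Spec} R$, its relative Betti stack over $R$ is the accessible fpqc sheaf of sets on the category of commutative $R$-algebras given by $$X^{\mathrm B/R}(S) = \operatorname{Map}_{\mathrm{Top}_{/\pi_0\operatorname{Spec} R}}(|\operatorname{Spec} S|, X),$$ where $|\operatorname{Spec} S|$ is regarded as a space over $\pi_0\operatorname{Spec} R$ through $|\operatorname{Spec} S| \to |\operatorname{Spec} R| \to \pi_0\operatorname{Spec} R$. Then the functor $X \mapsto X^{\mathrm B/R}$, from the category of compactly generated Hausdorff spaces over $\pi_0\operatorname{Spec} R$ and continuous maps over $\pi_0\operatorname{Spec} R$ to the category of stacks over $R$, is fully faithful. Here stacks over $R$ are accessible fpqc sheaves on the category of commutative $R$-algebras; the relative Betti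 stacks are set-valued ($0$-truncated), so that morphisms between them are morphisms of sheaves of sets. -/

import Mathlib

open CategoryTheory Limits AlgebraicGeometry

universe u

namespace RelativeBetti

/-! ### w-local rings -/

/-- A w-local space: a spectral space all of whose open covers split (the map from the disjoint
union of the cover has a continuous section), and whose set of closed points is closed. -/
class WLocalSpace (X : Type*) [TopologicalSpace X] : Prop extends SpectralSpace X where
  exists_section (U : Set (TopologicalSpace.Opens X)) (hU : ∀ x, ∃ V ∈ U, x ∈ V) :
    ∃ s : C(X, Σ V : U, (V : TopologicalSpace.Opens X)), ∀ x, ((s x).2 : X) = x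
  isClosed_closedPoints : IsClosed {x : X | IsClosed ({x} : Set X)}

/-- A w-local ring: a commutative ring whose prime spectrum is a w-local space. -/
class IsWLocalRing (R : Type*) [CommRing R] : Prop where
  wLocalSpace_primeSpectrum : WLocalSpace (PrimeSpectrum R)

/-! ### Auxiliary facts on prime spectra -/

/-- A continuous map out of `Spec S` descends to `Spec A` for a subring `A` of `S` which contains
witnesses for the disjointness of the fibres. -/
theorem exists_descent_of_separated {A S X : Type u} [CommRing A] [CommRing S]
    [TopologicalSpace X] [T1Space X] (φ : A →+* S) (hφ : Function.Injective φ)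
    (f : PrimeSpectrum S → X) (hf : Continuous f)
    (h : ∀ x y : X, x ≠ y → ∃ a b : A, a + b = 1 ∧
      φ a ∈ PrimeSpectrum.vanishingIdeal (f ⁻¹' {x}) ∧
      φ b ∈ PrimeSpectrum.vanishingIdeal (f ⁻¹' {y})) :
    ∃ g : PrimeSpectrum A → X, Continuous g ∧ (∀ q, g (PrimeSpectrum.comap φ q) = f q) ∧
      ∀ p, ∃ q, PrimeSpectrum.comap φ q ≤ p ∧ g p = f q := by
  have key : ∀ (p : PrimeSpectrum A) (I : Ideal S), I.comap φ ≤ p.asIdeal →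
      ∃ q : PrimeSpectrum S, I ≤ q.asIdeal ∧ PrimeSpectrum.comap φ q ≤ p := by
    intro p I hI
    have := p.isPrime
    obtain ⟨m, hm, hmp⟩ := Ideal.exists_minimalPrimes_le hI
    obtain ⟨q, hq, hIq, rfl⟩ := Ideal.exists_comap_eq_of_mem_minimalPrimes φ m hm
    exact ⟨⟨q, hq⟩, hIq, hmp⟩
  have ex : ∀ p : PrimeSpectrum A, ∃ q, PrimeSpectrum.comap φ q ≤ p := by
    intro p
    obtain ⟨q, -, hq⟩ := key p ⊥ (by
      rw [← RingHom.ker_eq_comap_bot, (RingHom.injective_iff_ker_eq_bot φ).1 hφ]; exact bot_le)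
    exact ⟨q, hq⟩
  have uniq : ∀ (p : PrimeSpectrum A) (q q' : PrimeSpectrum S),
      PrimeSpectrum.comap φ q ≤ p → PrimeSpectrum.comap φ q' ≤ p → f q = f q' := by
    intro p q q' hq hq'
    by_contra hne
    obtain ⟨a, b, hab, ha, hb⟩ := h _ _ hne
    rw [PrimeSpectrum.mem_vanishingIdeal] at ha hb
    have ha' : a ∈ p.asIdeal := hq (ha q rfl)
    have hb' : b ∈ p.asIdeal := hq' (hb q' rfl)
    exact p.isPrime.ne_top ((Ideal.eq_top_iff_one _).2 (hab ▸ add_mem ha' hb'))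
  choose c hc using ex
  refine ⟨fun p => f (c p), ?_, fun q => uniq _ _ _ (hc _) le_rfl, fun p => ⟨c p, hc p, rfl⟩⟩
  rw [continuous_iff_isClosed]
  intro Z hZ
  have hZ' := hZ.preimage hf
  have : (fun p => f (c p)) ⁻¹' Z = PrimeSpectrum.zeroLocus
      (((PrimeSpectrum.vanishingIdeal (f ⁻¹' Z)).comap φ : Ideal A) : Set A) := by
    ext p
    rw [PrimeSpectrum.mem_zeroLocus, SetLike.coe_subset_coe]
    constructor
    · intro hp a ha
      exact hc p ((PrimeSpectrum.mem_vanishingIdeal _ _).1 ha (c p) hp)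
    · intro hp
      obtain ⟨q, hq, hqp⟩ := key p _ hp
      have : q ∈ f ⁻¹' Z := by
        rw [← hZ'.closure_eq, ← PrimeSpectrum.zeroLocus_vanishingIdeal_eq_closure]
        exact hq
      change f (c p) ∈ Z
      rw [uniq p _ _ (hc p) hqp]
      exact this
  rw [this]
  exact PrimeSpectrum.isClosed_zeroLocus _


theorem comap_algebraMap_comap {R A B : Type u} [CommRing R] [CommRing A] [CommRing B] [Algebra R A]
    [Algebra R B] (φ : A →ₐ[R] B) (p : PrimeSpectrum B) :
    PrimeSpectrum.comap (algebraMap R A) (PrimeSpectrum.comap φ.toRingHom p) =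
      PrimeSpectrum.comap (algebraMap R B) p := by
  rw [← PrimeSpectrum.comap_comp_apply]
  congr 1
  exact φ.comp_algebraMap

theorem exists_add_eq_one_of_disjoint {S : Type u} [CommRing S] {Z W : Set (PrimeSpectrum S)}
    (hZ : IsClosed Z) (hW : IsClosed W) (h : Disjoint Z W) :
    ∃ a ∈ PrimeSpectrum.vanishingIdeal Z, 1 - a ∈ PrimeSpectrum.vanishingIdeal W := by
  have : PrimeSpectrum.vanishingIdeal Z ⊔ PrimeSpectrum.vanishingIdeal W = ⊤ := by
    rw [← PrimeSpectrum.zeroLocus_empty_iff_eq_top, PrimeSpectrum.zeroLocus_sup,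
      PrimeSpectrum.zeroLocus_vanishingIdeal_eq_closure,
      PrimeSpectrum.zeroLocus_vanishingIdeal_eq_closure, hZ.closure_eq, hW.closure_eq]
    exact h.inter_eq
  obtain ⟨a, ha, b, hb, hab⟩ := Submodule.mem_sup.1 ((Ideal.eq_top_iff_one _).1 this)
  exact ⟨a, ha, by rwa [← hab, add_sub_cancel_left]⟩

/-! ### The fpqc site of affine `R`-schemes and stacks over `R` -/

/-- Affine `R`-schemes, as the opposite of the category of commutative `R`-algebras. -/
abbrev Aff (R : Type u) [CommRing R] : Type (u + 1) := (CommAlgCat.{u} R)ᵒᵖ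

/-- The functor `S ↦ Spec S` to schemes. -/
noncomputable def affineToScheme (R : Type u) [CommRing R] : Aff R ⥤ Scheme.{u} :=
  (forget₂ (CommAlgCat.{u} R) CommRingCat.{u}).op ⋙ Scheme.Spec

instance (R : Type u) [CommRing R] : PreservesLimitsOfShape WalkingCospan (affineToScheme R) := by
  have : PreservesColimitsOfShape WalkingSpan (forget₂ (CommAlgCat.{u} R) CommRingCat.{u}) :=
    inferInstanceAs (PreservesColimitsOfShape WalkingSpan
      ((commAlgCatEquivUnder (.of R)).functor ⋙ Under.forget (CommRingCat.of R)))
  have : PreservesColimitsOfShape WalkingCospanᵒᵖ (forget₂ (CommAlgCat.{u} R) CommRingCat.{u}) :=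
    preservesColimitsOfShape_of_equiv walkingCospanOpEquiv.symm _
  have := preservesLimitsOfShape_op WalkingCospan (forget₂ (CommAlgCat.{u} R) CommRingCat.{u})
  unfold affineToScheme
  infer_instance

/-- The fpqc topology on affine `R`-schemes, generated by the families `Spec Sᵢ ⟶ Spec S` which
are fpqc covers: flat, jointly surjective, and quasi-compact as a family. -/
noncomputable def fpqcTopology (R : Type u) [CommRing R] : GrothendieckTopology (Aff R) :=
  (Scheme.fpqcPrecoverage.comap (affineToScheme R)).toGrothendieck

instance  (R : Type u) [CommRing R] :
    (affineToScheme R).IsContinuous (fpqcTopology R) Scheme.fpqcTopology :=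
  Functor.isContinuous_toGrothendieck_of_pullbacksPreservedBy _ _ _ le_rfl

/-- The property of being a `0`-truncated stack over `R`: an accessible fpqc sheaf of sets on the
category of `R`-algebras. Here a presheaf on `Aff R` is a functor on the double opposite of the
category of `R`-algebras; accessible means that it preserves `κ`-filtered colimits for some regular
cardinal `κ`. -/
def IsStack (R : Type u) [CommRing R] : ObjectProperty ((Aff R)ᵒᵖ ⥤ Type u) := fun F =>
  F.IsAccessible.{u} ∧ Presheaf.IsSheaf (fpqcTopology R) F

/-- The category of `0`-truncated stacks over `R`. It is a full subcategory of the `∞`-category of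
stacks over `R`, the mapping spaces between `0`-truncated objects being sets. -/
abbrev Stk (R : Type u) [CommRing R] := (IsStack R).FullSubcategory

/-! ### The relative Betti stack -/

/-- The space `π₀ Spec R` of connected components of `Spec R`, with the quotient topology. -/
abbrev piZeroSpec (R : Type u) [CommRing R] : TopCat.{u} :=
  TopCat.of (_root_.ConnectedComponents (PrimeSpectrum R))

/-- The functor sending an `R`-algebra `S` to the space `|Spec S|` over `π₀ Spec R`, with structure
map the composite `|Spec S| ⟶ |Spec R| ⟶ π₀ Spec R`. -/
def specOver (R : Type u) [CommRing R] : Aff R ⥤ Over (piZeroSpec R) where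
  obj S := Over.mk (Y := TopCat.of (PrimeSpectrum S.unop))
    (TopCat.ofHom ⟨fun p => _root_.ConnectedComponents.mk (PrimeSpectrum.comap (algebraMap R S.unop) p),
      _root_.ConnectedComponents.continuous_coe.comp (PrimeSpectrum.continuous_comap _)⟩)
  map {S T} φ := Over.homMk (TopCat.ofHom ⟨PrimeSpectrum.comap φ.unop.hom.toRingHom, PrimeSpectrum.continuous_comap _⟩) (by
    ext p
    exact congrArg _root_.ConnectedComponents.mk (comap_algebraMap_comap φ.unop.hom p))

/-- For a space `X` over `π₀ Spec R`, the presheaf `S ↦ Map_{/ π₀ Spec R} (|Spec S|, X)`,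
functorially in `X`. -/
abbrev relativeBettiPresheaf (R : Type u) [CommRing R] :
    Over (piZeroSpec R) ⥤ ((Aff R)ᵒᵖ ⥤ Type u) :=
  yoneda ⋙ (Functor.whiskeringLeft _ _ _).obj (specOver R).op

section

variable (R : Type u) [CommRing R] (X : Over (piZeroSpec R))

/-- The relative Betti presheaf of `X`, as a subpresheaf of `S ↦ C(|Spec S|, X)`. -/
noncomputable def relativeContinuousMaps : Subfunctor ((affineToScheme R).op ⋙ continuousMapPresheaf.{u,u} X.left) where
  obj S := { f : C(PrimeSpectrum S.unop.unop, X.left) |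
    ∀ p, X.hom (f p) = _root_.ConnectedComponents.mk (PrimeSpectrum.comap (algebraMap R S.unop.unop) p) }
  map {S T} φ f hf p := by
    refine (hf (PrimeSpectrum.comap φ.unop.unop.hom.toRingHom p)).trans
      (congrArg _root_.ConnectedComponents.mk (comap_algebraMap_comap φ.unop.unop.hom p))

noncomputable def relativeBettiPresheafIso : (relativeBettiPresheaf R).obj X ≅ (relativeContinuousMaps R X).toFunctor :=
  NatIso.ofComponents (fun S => Equiv.toIso
    { toFun f := ⟨f.left.hom, fun p => ConcreteCategory.congr_hom (Over.w f) p⟩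
      invFun f := Over.homMk (TopCat.ofHom f.1) (by ext p; exact f.2 p)
      left_inv f := rfl
      right_inv f := rfl }) (fun f => rfl)

theorem isSheaf_relativeBettiPresheaf : Presheaf.IsSheaf (fpqcTopology R) ((relativeBettiPresheaf R).obj X) := by
  have hG : ∀ (T : Type u) [TopologicalSpace T], Presheaf.IsSheaf (fpqcTopology R)
      ((affineToScheme R).op ⋙ continuousMapPresheaf.{u,u} T) := fun T _ =>
    Functor.op_comp_isSheaf_of_isSheaf (affineToScheme R) (fpqcTopology R) Scheme.fpqcTopology _
      (isSheaf_fpqcTopology_continuousMapPresheaf T)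
  rw [Presheaf.isSheaf_of_iso_iff (relativeBettiPresheafIso R X), isSheaf_iff_isSheaf_of_type,
    Subfunctor.isSheaf_iff _ ((isSheaf_iff_isSheaf_of_type _ _).1 (hG _))]
  intro S f hf
  let e : C(PrimeSpectrum S.unop.unop, piZeroSpec R) := ⟨fun p =>
    _root_.ConnectedComponents.mk (PrimeSpectrum.comap (algebraMap R S.unop.unop) p),
      _root_.ConnectedComponents.continuous_coe.comp (PrimeSpectrum.continuous_comap _)⟩
  let e' : C(PrimeSpectrum S.unop.unop, piZeroSpec R) :=
    (⟨X.hom, X.hom.hom.continuous⟩ : C(X.left, piZeroSpec R)).comp f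
  have := (((isSheaf_iff_isSheaf_of_type _ _).1 (hG (piZeroSpec R))).isSeparated _ hf).ext
    (t₁ := e') (t₂ := e) (by
      intro T g hg
      refine ContinuousMap.ext fun p => ?_
      refine (hg p).trans (congrArg _root_.ConnectedComponents.mk ?_)
      exact (comap_algebraMap_comap g.unop.hom p).symm)
  intro p
  exact congrArg (fun h : C(PrimeSpectrum S.unop.unop, piZeroSpec R) => h p) this

theorem isAccessible_relativeBettiPresheaf [T1Space X.left] : ((relativeBettiPresheaf R).obj X).IsAccessible.{u} := by
  let P := MvPolynomial (X.left × X.left) R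
  let κ := Order.succ (Cardinal.aleph0 + Cardinal.mk P + Cardinal.mk (X.left × X.left))
  have hκ : Fact κ.IsRegular :=
    ⟨Cardinal.isRegular_succ ((le_self_add (b := Cardinal.mk P)).trans le_self_add)⟩
  have hP : HasCardinalLT P κ := (hasCardinalLT_iff_cardinal_mk_lt _ _).2
    (Order.lt_succ_of_le (le_add_self.trans le_self_add))
  have hXX : HasCardinalLT (X.left × X.left) κ := (hasCardinalLT_iff_cardinal_mk_lt _ _).2
    (Order.lt_succ_of_le le_add_self)
  refine ⟨κ, hκ, ⟨fun J _ _ => ⟨fun {D} => ⟨fun {c} hc => ⟨?_⟩⟩⟩⟩⟩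
  have hJ : IsFiltered J := isFiltered_of_isCardinalFiltered J κ
  let U : (CommAlgCat.{u} R)ᵒᵖᵒᵖ ⥤ Type u := (opOpEquivalence _).functor ⋙
    (commAlgCatEquivUnder (.of R)).functor ⋙ Under.forget _ ⋙ forget CommRingCat.{u}
  have hU := isColimitOfPreserves U hc
  have surj : ∀ s : c.pt.unop.unop, ∃ (j : J) (t : (D.obj j).unop.unop),
      (c.ι.app j).unop.unop.hom t = s := fun s => Types.jointly_surjective_of_isColimit hU s
  have inj : ∀ (j : J) (t : (D.obj j).unop.unop), (c.ι.app j).unop.unop.hom t = 0 →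
      ∃ (k : J) (φ : j ⟶ k), (D.map φ).unop.unop.hom t = 0 := by
    intro j t ht
    obtain ⟨k, φ, h⟩ := (Types.FilteredColimit.isColimit_eq_iff' hU (i := j) t
      (0 : (D.obj j).unop.unop)).1 (ht.trans (map_zero (c.ι.app j).unop.unop.hom).symm)
    exact ⟨k, φ, h.trans (map_zero (D.map φ).unop.unop.hom)⟩
  have nat : ∀ {j k : J} (φ : j ⟶ k) (t : (D.obj j).unop.unop),
      (c.ι.app k).unop.unop.hom ((D.map φ).unop.unop.hom t) = (c.ι.app j).unop.unop.hom t := by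
    intro j k φ t
    rw [← c.w φ]
    rfl
  have hcomp : ∀ {j k : J} (φ : j ⟶ k) {l : J} (ψ : k ⟶ l) (t : (D.obj j).unop.unop),
      (D.map (φ ≫ ψ)).unop.unop.hom t = (D.map ψ).unop.unop.hom ((D.map φ).unop.unop.hom t) := by
    intro j k φ l ψ t
    rw [D.map_comp]
    rfl
  -- fewer than `κ` elements dying in the colimit die simultaneously
  have kill : ∀ (j : J) (K : Type u) (t : K → (D.obj j).unop.unop), HasCardinalLT K κ →
      (∀ i, (c.ι.app j).unop.unop.hom (t i) = 0) →
      ∃ (k : J) (φ : j ⟶ k), ∀ i, (D.map φ).unop.unop.hom (t i) = 0 := by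
    intro j K t hK ht
    choose k φ h using fun i => inj j (t i) (ht i)
    obtain ⟨m, a, b, hm⟩ := IsCardinalFiltered.wideSpan φ hK
    refine ⟨m, b, fun i => ?_⟩
    rw [← hm i, hcomp, h, map_zero]
  refine Types.FilteredColimit.isColimitOf _ _ ?_ ?_
  · intro (F : (specOver R).obj c.pt.unop ⟶ X)
    let f : C(PrimeSpectrum c.pt.unop.unop, X.left) := F.left.hom
    have hw : ∀ z : X.left × X.left, ∃ a : c.pt.unop.unop, z.1 ≠ z.2 →
        a ∈ PrimeSpectrum.vanishingIdeal (f ⁻¹' {z.1}) ∧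
        1 - a ∈ PrimeSpectrum.vanishingIdeal (f ⁻¹' {z.2}) := by
      intro z
      by_cases hz : z.1 = z.2
      · exact ⟨0, fun h => absurd hz h⟩
      · obtain ⟨a, h1, h2⟩ := exists_add_eq_one_of_disjoint
          ((isClosed_singleton (x := z.1)).preimage f.continuous)
          ((isClosed_singleton (x := z.2)).preimage f.continuous)
          ((Set.disjoint_singleton.2 hz).preimage f)
        exact ⟨a, fun _ => ⟨h1, h2⟩⟩
    choose a ha using hw
    choose j t ht using fun z => surj (a z)
    let m₀ := IsCardinalFiltered.max j hXX
    let ψ : P →ₐ[R] (D.obj m₀).unop.unop := MvPolynomial.aeval fun z =>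
      (D.map (IsCardinalFiltered.toMax j hXX z)).unop.unop.hom (t z)
    let ω : P →ₐ[R] c.pt.unop.unop := (c.ι.app m₀).unop.unop.hom.comp ψ
    have hω : ∀ z, ω (MvPolynomial.X z) = a z := by
      intro z
      change (c.ι.app m₀).unop.unop.hom (ψ (MvPolynomial.X z)) = a z
      rw [MvPolynomial.aeval_X, nat, ht]
    obtain ⟨m, φ, hm⟩ := kill m₀ (RingHom.ker ω) (fun k => ψ k)
      (hP.of_injective _ Subtype.val_injective) (fun k => k.2)
    let A := P ⧸ RingHom.ker ω
    let θ : A →ₐ[R] c.pt.unop.unop := Ideal.kerLiftAlg ω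
    let χ : A →ₐ[R] (D.obj m).unop.unop := Ideal.Quotient.liftₐ (RingHom.ker ω)
      ((D.map φ).unop.unop.hom.comp ψ) (fun k hk => hm ⟨k, hk⟩)
    have hχ : (c.ι.app m).unop.unop.hom.comp χ = θ := by
      refine Ideal.Quotient.algHom_ext _ (AlgHom.ext fun x => ?_)
      exact nat φ (ψ x)
    obtain ⟨g, hg, hgf, hgq⟩ := exists_descent_of_separated θ.toRingHom
      (Ideal.kerLiftAlg_injective ω) f f.continuous (by
        intro x y hxy
        refine ⟨Ideal.Quotient.mk _ (MvPolynomial.X (x, y)),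
          1 - Ideal.Quotient.mk _ (MvPolynomial.X (x, y)), add_sub_cancel _ _, ?_, ?_⟩
        · have : θ (Ideal.Quotient.mk _ (MvPolynomial.X (x, y))) = a (x, y) := hω _
          change θ _ ∈ _
          rw [this]
          exact (ha (x, y) hxy).1
        · have : θ (Ideal.Quotient.mk _ (MvPolynomial.X (x, y))) = a (x, y) := hω _
          change θ _ ∈ _
          rw [map_sub, map_one, this]
          exact (ha (x, y) hxy).2)
    let G : (specOver R).obj (D.obj m).unop ⟶ X := Over.homMk
      (TopCat.ofHom ⟨fun p => g (PrimeSpectrum.comap χ.toRingHom p),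
        hg.comp (PrimeSpectrum.continuous_comap _)⟩) (by
        ext p
        obtain ⟨q, hq, hq'⟩ := hgq (PrimeSpectrum.comap χ.toRingHom p)
        change X.hom (g _) = _root_.ConnectedComponents.mk _
        rw [hq']
        refine (ConcreteCategory.congr_hom (Over.w F) q).trans ?_
        change _root_.ConnectedComponents.mk _ = _
        rw [← comap_algebraMap_comap χ p, ← comap_algebraMap_comap θ q]
        refine ConnectedComponents.coe_eq_coe'.2 ?_
        have hs : PrimeSpectrum.comap (algebraMap R A) (PrimeSpectrum.comap θ.toRingHom q) ⤳
            PrimeSpectrum.comap (algebraMap R A) (PrimeSpectrum.comap χ.toRingHom p) :=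
          ((PrimeSpectrum.le_iff_specializes _ _).1 hq).map (PrimeSpectrum.continuous_comap _)
        rw [connectedComponent_eq_iff_mem.2 (isPreconnected_singleton.closure.subset_connectedComponent
          (subset_closure rfl) hs.mem_closure)]
        exact mem_connectedComponent)
    refine ⟨m, G, ?_⟩
    refine Over.OverMorphism.ext (TopCat.hom_ext (ContinuousMap.ext fun q => ?_))
    change f q = g (PrimeSpectrum.comap χ.toRingHom
      (PrimeSpectrum.comap (c.ι.app m).unop.unop.hom.toRingHom q))
    rw [← hgf q, ← hχ]
    rfl
  · intro i j (F : (specOver R).obj (D.obj i).unop ⟶ X)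
      (G : (specOver R).obj (D.obj j).unop ⟶ X) hFG
    let k := IsFiltered.max i j
    let f : C(PrimeSpectrum (D.obj k).unop.unop, X.left) :=
      (((specOver R).map (D.map (IsFiltered.leftToMax i j)).unop) ≫ F).left.hom
    let g : C(PrimeSpectrum (D.obj k).unop.unop, X.left) :=
      (((specOver R).map (D.map (IsFiltered.rightToMax i j)).unop) ≫ G).left.hom
    have hfg : ∀ q : PrimeSpectrum c.pt.unop.unop,
        f (PrimeSpectrum.comap (c.ι.app k).unop.unop.hom.toRingHom q) =
        g (PrimeSpectrum.comap (c.ι.app k).unop.unop.hom.toRingHom q) := by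
      intro q
      have e1 : PrimeSpectrum.comap (D.map (IsFiltered.leftToMax i j)).unop.unop.hom.toRingHom
          (PrimeSpectrum.comap (c.ι.app k).unop.unop.hom.toRingHom q) =
          PrimeSpectrum.comap (c.ι.app i).unop.unop.hom.toRingHom q := by
        rw [← c.w (IsFiltered.leftToMax i j)]
        rfl
      have e2 : PrimeSpectrum.comap (D.map (IsFiltered.rightToMax i j)).unop.unop.hom.toRingHom
          (PrimeSpectrum.comap (c.ι.app k).unop.unop.hom.toRingHom q) =
          PrimeSpectrum.comap (c.ι.app j).unop.unop.hom.toRingHom q := by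
        rw [← c.w (IsFiltered.rightToMax i j)]
        rfl
      have e3 := congrArg (fun H : (specOver R).obj c.pt.unop ⟶ X => H.left.hom q) hFG
      exact (congrArg F.left.hom e1).trans (e3.trans (congrArg G.left.hom e2).symm)
    let I : X.left × X.left → Ideal (D.obj k).unop.unop := fun z =>
      PrimeSpectrum.vanishingIdeal (f ⁻¹' {z.1}) ⊔ PrimeSpectrum.vanishingIdeal (g ⁻¹' {z.2})
    have hI : ∀ z p, I z ≤ PrimeSpectrum.asIdeal p ↔ f p = z.1 ∧ g p = z.2 := by
      intro z p
      have h1 := ((isClosed_singleton (x := z.1)).preimage f.continuous).closure_eq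
      have h2 := ((isClosed_singleton (x := z.2)).preimage g.continuous).closure_eq
      rw [← PrimeSpectrum.zeroLocus_vanishingIdeal_eq_closure] at h1 h2
      rw [sup_le_iff]
      exact and_congr (Set.ext_iff.1 h1 p) (Set.ext_iff.1 h2 p)
    have top : ∀ z : {z : X.left × X.left // z.1 ≠ z.2}, ∃ (l : J) (φ : k ⟶ l),
        (1 : (D.obj l).unop.unop) ∈ (I z).map (D.map φ).unop.unop.hom.toRingHom := by
      intro z
      have h1 : (1 : c.pt.unop.unop) ∈ (I z).map (c.ι.app k).unop.unop.hom.toRingHom := by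
        rw [← Ideal.eq_top_iff_one]
        by_contra hne
        obtain ⟨q, hq, hle⟩ := Ideal.exists_le_maximal _ hne
        have hp := (hI z (PrimeSpectrum.comap (c.ι.app k).unop.unop.hom.toRingHom
          ⟨q, hq.isPrime⟩)).1 (Ideal.map_le_iff_le_comap.1 hle)
        exact z.2 (hp.1.symm.trans ((hfg _).trans hp.2))
      have push : ∀ {l l' : J} (φ : k ⟶ l) (φ' : l ⟶ l') (t : (D.obj l).unop.unop),
          t ∈ (I z).map (D.map φ).unop.unop.hom.toRingHom →
          (D.map φ').unop.unop.hom t ∈ (I z).map (D.map (φ ≫ φ')).unop.unop.hom.toRingHom := by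
        intro l l' φ φ' t ht
        have := Ideal.mem_map_of_mem (D.map φ').unop.unop.hom.toRingHom ht
        rw [Ideal.map_map] at this
        rw [D.map_comp]
        exact this
      have h2 : ∀ s ∈ (I z).map (c.ι.app k).unop.unop.hom.toRingHom,
          ∃ (l : J) (φ : k ⟶ l) (t : (D.obj l).unop.unop),
            t ∈ (I z).map (D.map φ).unop.unop.hom.toRingHom ∧
            (c.ι.app l).unop.unop.hom t = s := by
        intro s hs
        induction hs using Submodule.span_induction with
        | mem s hs =>
          obtain ⟨t, ht, rfl⟩ := hs
          exact ⟨k, 𝟙 k, _, Ideal.mem_map_of_mem _ ht, nat (𝟙 k) t⟩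
        | zero => exact ⟨k, 𝟙 k, 0, zero_mem _, map_zero _⟩
        | add s s' _ _ hs hs' =>
          obtain ⟨l, φ, t, ht, rfl⟩ := hs
          obtain ⟨l', φ', t', ht', rfl⟩ := hs'
          obtain ⟨n, α, β, e⟩ := IsFiltered.span φ φ'
          refine ⟨n, φ ≫ α, _, add_mem (push φ α t ht) (e ▸ push φ' β t' ht'), ?_⟩
          rw [map_add, nat, nat]
        | smul r s _ hs =>
          obtain ⟨l, φ, t, ht, rfl⟩ := hs
          obtain ⟨l', r, rfl⟩ := surj r
          refine ⟨_, φ ≫ IsFiltered.leftToMax l l', _, Ideal.mul_mem_left _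
            ((D.map (IsFiltered.rightToMax l l')).unop.unop.hom r) (push φ _ t ht), ?_⟩
          rw [map_mul, nat, nat]
          rfl
      obtain ⟨l, φ, t, ht, h1⟩ := h2 1 h1
      obtain ⟨l', φ', h⟩ := inj l (t - 1) (by rw [map_sub, map_one, h1, sub_self])
      rw [map_sub, map_one, sub_eq_zero] at h
      exact ⟨l', φ ≫ φ', h ▸ push φ φ' t ht⟩
    choose l φ hl using top
    obtain ⟨m, α, β, hm⟩ := IsCardinalFiltered.wideSpan φ
      (hXX.of_injective _ Subtype.val_injective)
    refine ⟨m, IsFiltered.leftToMax i j ≫ β, IsFiltered.rightToMax i j ≫ β, ?_⟩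
    rw [Functor.map_comp, Functor.map_comp]
    refine Over.OverMorphism.ext (TopCat.hom_ext (ContinuousMap.ext fun p => ?_))
    change f (PrimeSpectrum.comap (D.map β).unop.unop.hom.toRingHom p) =
      g (PrimeSpectrum.comap (D.map β).unop.unop.hom.toRingHom p)
    by_contra hne
    let z : {z : X.left × X.left // z.1 ≠ z.2} := ⟨(_, _), hne⟩
    have h1 : I z ≤ (PrimeSpectrum.comap (D.map β).unop.unop.hom.toRingHom p).asIdeal :=
      (hI _ _).2 ⟨rfl, rfl⟩
    have h2 : I z ≤ (PrimeSpectrum.comap (D.map (φ z)).unop.unop.hom.toRingHom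
        (PrimeSpectrum.comap (D.map (α z)).unop.unop.hom.toRingHom p)).asIdeal := by
      rw [← hm z, D.map_comp] at h1
      exact h1
    have h3 := Ideal.map_le_iff_le_comap.2 h2 (hl z)
    exact (PrimeSpectrum.comap (D.map (α z)).unop.unop.hom.toRingHom p).isPrime.ne_top
      ((Ideal.eq_top_iff_one _).2 h3)

end

/-- Compactly generated Hausdorff spaces. -/
def IsCGHaus : ObjectProperty TopCat.{u} := fun X => UCompactlyGeneratedSpace.{u} X ∧ T2Space X

/-- The category of compactly generated Hausdorff spaces and continuous maps. -/
abbrev CGHaus := IsCGHaus.{u}.FullSubcategory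

/-- The category of compactly generated Hausdorff spaces over a space `B`. -/
abbrev CGHausOver (B : TopCat.{u}) := CostructuredArrow IsCGHaus.{u}.ι B

/-- The functor sending a compactly generated Hausdorff space `X` over `π₀ Spec R` to its relative
Betti stack `S ↦ Map_{/ π₀ Spec R} (|Spec S|, X)`. -/
noncomputable def relativeBettiStack (R : Type u) [CommRing R] :
    CGHausOver (piZeroSpec R) ⥤ Stk R :=
  (IsStack R).lift (CostructuredArrow.toOver IsCGHaus.{u}.ι (piZeroSpec R) ⋙
    relativeBettiPresheaf R) fun X => by
      have : T2Space ((CostructuredArrow.toOver IsCGHaus.{u}.ι (piZeroSpec R)).obj X).left :=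
        X.left.property.2
      exact ⟨isAccessible_relativeBettiPresheaf R _, isSheaf_relativeBettiPresheaf R _⟩

end RelativeBetti

/-!
Write `P = π₀ Spec R`. Since open covers of `Spec R` split, distinct closed points are separated by
clopen sets; hence `P` is Hausdorff and each connected component contains a closed point `m` to
which all of its points specialize (`WLocalSpace.specializes_of_isClosed`).

Let `η` be a transformation from the relative Betti stack of `X` to that of `Y`. A point `x : X`
over the component of `m` gives a constant section over the local ring `R_m`, and `η` sends it to a
continuous map `Spec R_m → Y`, whose value at the closed point is called `f x`. For an arbitrary
`R`-algebra `S`, a section `φ : Spec S → X` and a prime `p` of `S` with `φ p = x`, the residue field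
of `p` receives maps from `S` and from `R_m`, and `φ` and the constant section `x` have the same
restriction to it. By naturality `η φ = f ∘ φ` (`evalSection_mapSection`); that `Y` is `T1` makes
its maps out of `Spec R_m` constant.

It remains to see that `f` is continuous, which may be tested on maps `g : K → X` from compact
Hausdorff spaces. There is an `R`-algebra `S` with a quotient map `π : Spec S → K` over `P`
(`exists_isQuotientMap_primeSpectrum`): for `S` a product of domains `R ⧸ p t` indexed by `t : K`,
a prime of `S` determines an ultrafilter on `K`, and `π` takes its limit. Then
`f ∘ g ∘ π = η (g ∘ π)` is continuous, and so is `f ∘ g`.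

Faithfulness is immediate, as a map is determined by its values on constant sections.
-/

/-! ### Connected components of w-local spaces -/

namespace RelativeBetti

/-- Two distinct closed points `x` and `y` are separated by a clopen set: split the cover by the
complements of `x` and of `y`. -/
theorem WLocalSpace.exists_isClopen_separating {X : Type*} [TopologicalSpace X] [WLocalSpace X]
    {x y : X} (hx : IsClosed ({x} : Set X)) (hy : IsClosed ({y} : Set X)) (hxy : x ≠ y) :
    ∃ A : Set X, IsClopen A ∧ x ∈ A ∧ y ∉ A := by
  let Ux : TopologicalSpace.Opens X := ⟨{x}ᶜ, hx.isOpen_compl⟩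
  let Uy : TopologicalSpace.Opens X := ⟨{y}ᶜ, hy.isOpen_compl⟩
  obtain ⟨s, hs⟩ := exists_section ({Ux, Uy} : Set (TopologicalSpace.Opens X)) fun z => by
    by_cases hz : z = x
    · exact ⟨Uy, by simp, fun h => hxy (hz.symm.trans h)⟩
    · exact ⟨Ux, by simp, hz⟩
  let i : {V // V ∈ ({Ux, Uy} : Set (TopologicalSpace.Opens X))} := ⟨Uy, by simp⟩
  have hclopen : IsClopen (Sigma.fst ⁻¹' {i} : Set (Σ V : {V // V ∈ ({Ux, Uy} : Set _)},
      (V : TopologicalSpace.Opens X))) := by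
    rw [← Set.range_sigmaMk]
    exact isClopen_range_sigmaMk
  refine ⟨_, hclopen.preimage s.continuous, ?_, fun h => ?_⟩
  · have h2 := (s x).2.2
    rw [hs x] at h2
    rcases (s x).1.2 with h | h
    · exact absurd rfl (h ▸ h2 : x ∈ Ux)
    · exact Subtype.ext h
  · have h2 := (s y).2.2
    rw [hs y, (h : (s y).1 = i)] at h2
    exact h2 rfl

/-- Distinct closed points of a w-local space lie in distinct connected components. -/
theorem WLocalSpace.eq_of_isClosed_of_coe_eq {X : Type*} [TopologicalSpace X] [WLocalSpace X]
    {x y : X} (hx : IsClosed ({x} : Set X)) (hy : IsClosed ({y} : Set X))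
    (h : (x : _root_.ConnectedComponents X) = y) : x = y := by
  by_contra hxy
  obtain ⟨A, hA, hxA, hyA⟩ := exists_isClopen_separating hx hy hxy
  refine hyA (hA.connectedComponent_subset hxA ?_)
  rw [ConnectedComponents.coe_eq_coe.1 h]
  exact mem_connectedComponent

/-- Every connected component of a w-local space contains a closed point. -/
theorem WLocalSpace.exists_isClosed_coe_eq {X : Type*} [TopologicalSpace X] [WLocalSpace X]
    (c : _root_.ConnectedComponents X) : ∃ m : X, IsClosed ({m} : Set X) ∧ (m : _) = c := by
  obtain ⟨x, rfl⟩ := ConnectedComponents.surjective_coe c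
  obtain ⟨m, hm, hmc⟩ := isClosed_connectedComponent.exists_closed_singleton
    (⟨x, mem_connectedComponent⟩ : (connectedComponent x).Nonempty)
  exact ⟨m, hmc, ConnectedComponents.coe_eq_coe'.2 hm⟩

/-- A closed point of a w-local space is a specialization of every point of its component. -/
theorem WLocalSpace.specializes_of_isClosed {X : Type*} [TopologicalSpace X] [WLocalSpace X]
    {m q : X} (hm : IsClosed ({m} : Set X)) (h : (q : _root_.ConnectedComponents X) = m) :
    q ⤳ m := by
  obtain ⟨n, hn, hnc⟩ := (isClosed_closure (s := {q})).exists_closed_singleton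
    ⟨q, subset_closure rfl⟩
  have hqn : (n : _root_.ConnectedComponents X) = q := ConnectedComponents.coe_eq_coe'.2
    (isPreconnected_singleton.closure.subset_connectedComponent (subset_closure rfl) hn)
  rw [← eq_of_isClosed_of_coe_eq hnc hm (hqn.trans h)]
  exact specializes_iff_mem_closure.2 hn

instance WLocalSpace.t2Space_connectedComponents {X : Type*} [TopologicalSpace X]
    [WLocalSpace X] : T2Space (_root_.ConnectedComponents X) := by
  refine ⟨fun c d hcd => ?_⟩
  obtain ⟨x, hx, rfl⟩ := exists_isClosed_coe_eq c
  obtain ⟨y, hy, rfl⟩ := exists_isClosed_coe_eq d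
  obtain ⟨A, hA, hxA, hyA⟩ := exists_isClopen_separating hx hy fun h => hcd (congrArg _ h)
  -- a clopen set is a union of components, hence descends to a clopen set of components
  have hsat : ∀ B : Set X, IsClopen B →
      ((↑) : X → _root_.ConnectedComponents X) ⁻¹' ((↑) '' B) = B := fun B hB => by
    rw [connectedComponents_preimage_image, hB.biUnion_connectedComponent_eq]
  have hopen : ∀ B : Set X, IsClopen B →
      IsOpen (((↑) : X → _root_.ConnectedComponents X) '' B) := fun B hB => by
    rw [← ConnectedComponents.isQuotientMap_coe.isOpen_preimage, hsat B hB]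
    exact hB.isOpen
  refine ⟨_, _, hopen A hA, hopen Aᶜ hA.compl, ⟨x, hxA, rfl⟩, ⟨y, hyA, rfl⟩, ?_⟩
  rw [← Set.disjoint_preimage_iff ConnectedComponents.surjective_coe, hsat A hA,
    hsat _ hA.compl]
  exact disjoint_compl_right

end RelativeBetti

/-! ### The spectrum of a product of rings and ultrafilters -/

namespace PrimeSpectrum

variable {K : Type*} {A : K → Type*} [∀ t, CommRing (A t)]

variable (A) in
open Classical in
/-- The indicator function of a set `s` of indices, an idempotent of `∏ t : K, A t`. -/
noncomputable def piIndicator (s : Set K) : ∀ t, A t :=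
  s.piecewise 1 0

theorem piIndicator_of_mem {s : Set K} {t : K} (ht : t ∈ s) : piIndicator A s t = 1 := by
  classical exact Set.piecewise_eq_of_mem _ _ _ ht

theorem piIndicator_of_notMem {s : Set K} {t : K} (ht : t ∉ s) : piIndicator A s t = 0 := by
  classical exact Set.piecewise_eq_of_notMem _ _ _ ht

theorem piIndicator_inter (s s' : Set K) :
    piIndicator A (s ∩ s') = piIndicator A s * piIndicator A s' := by
  ext t
  by_cases ht : t ∈ s <;> by_cases ht' : t ∈ s' <;>
    simp [piIndicator_of_mem, piIndicator_of_notMem, ht, ht']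

theorem piIndicator_add_compl (s : Set K) : piIndicator A s + piIndicator A sᶜ = 1 := by
  ext t
  by_cases ht : t ∈ s <;> simp [piIndicator_of_mem, piIndicator_of_notMem, ht]

theorem piIndicator_mul_compl (s : Set K) : piIndicator A s * piIndicator A sᶜ = 0 := by
  ext t
  by_cases ht : t ∈ s <;> simp [piIndicator_of_mem, piIndicator_of_notMem, ht]

/-- The ultrafilter on `K` attached to a prime `q` of `∏ t : K, A t`: a set belongs to it when its
indicator function is not in `q`. -/
noncomputable def piUltrafilter (q : PrimeSpectrum (∀ t, A t)) : Ultrafilter K :=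
  Ultrafilter.ofComplNotMemIff
    { sets := {s | piIndicator A s ∉ q.asIdeal}
      univ_sets := by
        simpa [piIndicator] using (Ideal.ne_top_iff_one _).1 q.isPrime.ne_top
      sets_of_superset := by
        intro s s' hs hss' h
        refine hs ?_
        rw [← Set.inter_eq_left.2 hss', piIndicator_inter]
        exact Ideal.mul_mem_left _ _ h
      inter_sets := by
        intro s s' hs hs' h
        rw [piIndicator_inter] at h
        exact (q.isPrime.mem_or_mem h).elim hs hs' }
    (by
      intro s
      change ¬ (piIndicator A sᶜ ∉ q.asIdeal) ↔ piIndicator A s ∉ q.asIdeal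
      rw [not_not]
      constructor
      · intro h h'
        refine q.isPrime.ne_top ((Ideal.eq_top_iff_one _).2 ?_)
        rw [← piIndicator_add_compl s]
        exact add_mem h' h
      · intro h
        refine (q.isPrime.mem_or_mem ?_).resolve_left h
        rw [piIndicator_mul_compl]
        exact zero_mem _)

theorem mem_piUltrafilter {q : PrimeSpectrum (∀ t, A t)} {s : Set K} :
    s ∈ piUltrafilter q ↔ piIndicator A s ∉ q.asIdeal :=
  Iff.rfl

theorem continuous_piUltrafilter :
    Continuous (piUltrafilter : PrimeSpectrum (∀ t, A t) → Ultrafilter K) := by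
  rw [ultrafilterBasis_is_basis.continuous_iff]
  rintro _ ⟨s, rfl⟩
  exact (basicOpen (piIndicator A s)).isOpen

theorem piUltrafilter_comap_eval (t : K) (z : PrimeSpectrum (A t)) :
    piUltrafilter (comap (Pi.evalRingHom A t) z) = pure t := by
  refine Ultrafilter.ext fun s => ?_
  rw [mem_piUltrafilter, Ultrafilter.mem_pure]
  by_cases ht : t ∈ s
  · simpa [ht, piIndicator_of_mem] using (Ideal.ne_top_iff_one _).1 z.isPrime.ne_top
  · simp [ht, piIndicator_of_notMem]

/-- The generic points of the factors are dense in the spectrum of a product of domains. -/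
theorem denseRange_comap_eval_bot [∀ t, IsDomain (A t)] :
    DenseRange fun t => comap (Pi.evalRingHom A t) (⊥ : PrimeSpectrum (A t)) := by
  rw [DenseRange, dense_iff_closure_eq, ← zeroLocus_vanishingIdeal_eq_closure]
  refine Set.eq_univ_of_forall fun q f hf => ?_
  have : f = 0 := funext fun t => (mem_vanishingIdeal _ _).1 hf _ ⟨t, rfl⟩
  rw [this]
  exact zero_mem _

end PrimeSpectrum

namespace RelativeBetti

/-! ### Naturality of transformations between relative Betti presheaves -/

variable {R : Type u} [CommRing R] {X Y : Over (piZeroSpec R)}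

/-- The continuous map over `π₀ Spec R` attached to a section of the relative Betti presheaf. -/
abbrev evalSection {S : Type u} [CommRing S] [Algebra R S]
    (φ : (specOver R).obj (.op (CommAlgCat.of R S)) ⟶ X) : C(PrimeSpectrum S, X.left) :=
  φ.left.hom

theorem hom_evalSection {S : Type u} [CommRing S] [Algebra R S]
    (φ : (specOver R).obj (.op (CommAlgCat.of R S)) ⟶ X) (p : PrimeSpectrum S) :
    X.hom (evalSection φ p) =
      _root_.ConnectedComponents.mk (PrimeSpectrum.comap (algebraMap R S) p) :=
  ConcreteCategory.congr_hom (Over.w φ) p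

/-- The section of the relative Betti presheaf attached to a continuous map over `π₀ Spec R`. -/
def sectionMk {S : Type u} [CommRing S] [Algebra R S] (f : C(PrimeSpectrum S, X.left))
    (hf : ∀ p, X.hom (f p) =
      _root_.ConnectedComponents.mk (PrimeSpectrum.comap (algebraMap R S) p)) :
    (specOver R).obj (.op (CommAlgCat.of R S)) ⟶ X :=
  Over.homMk (TopCat.ofHom f) (by ext p; exact hf p)

theorem section_ext {S : Type u} [CommRing S] [Algebra R S]
    {φ ψ : (specOver R).obj (.op (CommAlgCat.of R S)) ⟶ X}
    (h : ∀ p, evalSection φ p = evalSection ψ p) : φ = ψ :=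
  Over.OverMorphism.ext (TopCat.hom_ext (ContinuousMap.ext h))

/-- The action of a transformation of relative Betti presheaves on sections. -/
abbrev mapSection (η : (relativeBettiPresheaf R).obj X ⟶ (relativeBettiPresheaf R).obj Y)
    {S : Type u} [CommRing S] [Algebra R S]
    (φ : (specOver R).obj (.op (CommAlgCat.of R S)) ⟶ X) :
    (specOver R).obj (.op (CommAlgCat.of R S)) ⟶ Y :=
  η.app (.op (.op (CommAlgCat.of R S))) φ

theorem evalSection_mapSection_comap
    (η : (relativeBettiPresheaf R).obj X ⟶ (relativeBettiPresheaf R).obj Y)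
    {S T : Type u} [CommRing S] [Algebra R S] [CommRing T] [Algebra R T] (ψ : S →ₐ[R] T)
    (φ : (specOver R).obj (.op (CommAlgCat.of R S)) ⟶ X)
    (φ' : (specOver R).obj (.op (CommAlgCat.of R T)) ⟶ X)
    (h : ∀ q, evalSection φ' q = evalSection φ (PrimeSpectrum.comap ψ.toRingHom q))
    (q : PrimeSpectrum T) :
    evalSection (mapSection η φ') q =
      evalSection (mapSection η φ) (PrimeSpectrum.comap ψ.toRingHom q) := by
  have e : φ' = (specOver R).map (CommAlgCat.ofHom ψ).op ≫ φ := section_ext h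
  rw [e]
  have := ConcreteCategory.congr_hom (η.naturality (CommAlgCat.ofHom ψ).op.op) φ
  exact congrArg (fun χ => evalSection (X := Y) (S := T) χ q) this

/-- The constant section with value `x` over the local ring of `Spec R` at a point `m` of the
component of `x`. -/
noncomputable def constSection (m : PrimeSpectrum R) (x : X.left)
    (h : X.hom x = _root_.ConnectedComponents.mk m) :
    (specOver R).obj (.op (CommAlgCat.of R (Localization.AtPrime m.asIdeal))) ⟶ X :=
  sectionMk (ContinuousMap.const _ x) fun p => by
    refine h.trans (ConnectedComponents.coe_eq_coe'.2 ?_)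
    have hs : PrimeSpectrum.comap (algebraMap R (Localization.AtPrime m.asIdeal)) p ⤳ m := by
      rw [← PrimeSpectrum.le_iff_specializes]
      have := (PrimeSpectrum.le_iff_specializes _ _).2
        (IsLocalRing.specializes_closedPoint p)
      intro r hr
      by_contra hrm
      exact (IsLocalRing.mem_maximalIdeal _).1 (this hr)
        (IsLocalization.map_units (M := m.asIdeal.primeCompl) _ ⟨r, hrm⟩)
    exact isPreconnected_singleton.closure.subset_connectedComponent
      (subset_closure rfl) hs.mem_closure

/-- A transformation `η` is determined on a section `φ` and at a point `p` by its value on the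
constant section over the local ring at any specialization `m` of the image of `p`: both sections
restrict to the same one over the residue field of `p`, as it receives the local ring at `m`. -/
theorem evalSection_mapSection [T1Space Y.left]
    (η : (relativeBettiPresheaf R).obj X ⟶ (relativeBettiPresheaf R).obj Y)
    {S : Type u} [CommRing S] [Algebra R S]
    (φ : (specOver R).obj (.op (CommAlgCat.of R S)) ⟶ X) (p : PrimeSpectrum S)
    (m : PrimeSpectrum R) (x : X.left) (hx : X.hom x = _root_.ConnectedComponents.mk m)
    (hm : PrimeSpectrum.comap (algebraMap R S) p ⤳ m) (hpx : evalSection φ p = x) :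
    evalSection (mapSection η φ) p =
      evalSection (mapSection η (constSection m x hx)) (IsLocalRing.closedPoint _) := by
  let α : S →ₐ[R] p.asIdeal.ResidueField := IsScalarTower.toAlgHom R S _
  let β : Localization.AtPrime m.asIdeal →ₐ[R] p.asIdeal.ResidueField :=
    IsLocalization.liftAlgHom (M := m.asIdeal.primeCompl)
      (f := Algebra.ofId R p.asIdeal.ResidueField) fun y => by
      rw [isUnit_iff_ne_zero, Algebra.ofId_apply, IsScalarTower.algebraMap_apply R S, Ne,
        Ideal.algebraMap_residueField_eq_zero]
      exact fun h => y.2 ((PrimeSpectrum.le_iff_specializes _ _).2 hm h)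
  have hα : ∀ q, PrimeSpectrum.comap α.toRingHom q = p := by
    intro q
    ext r
    have hq : q = ⊥ := Subsingleton.elim _ _
    subst hq
    exact Ideal.algebraMap_residueField_eq_zero
  let χ : (specOver R).obj (.op (CommAlgCat.of R p.asIdeal.ResidueField)) ⟶ X :=
    (specOver R).map (CommAlgCat.ofHom α).op ≫ φ
  have h1 := evalSection_mapSection_comap η α φ χ (fun _ => rfl) ⊥
  have h2 := evalSection_mapSection_comap η β (constSection m x hx) χ (fun q =>
    (congrArg (evalSection φ) (hα q)).trans hpx) ⊥
  rw [hα] at h1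
  rw [← h1, h2]
  -- a map to a `T1` space takes the same value at a point and at its specialization
  exact ((IsLocalRing.specializes_closedPoint _).map (evalSection _).continuous).eq

/-! ### Test algebras for continuity -/

/-- Every compact Hausdorff space `K` over `π₀ Spec R` is a quotient over `π₀ Spec R` of the
spectrum of some `R`-algebra: the product over `t ∈ K` of the domains `R ⧸ p t`, with `p t` a point
of the component below `t`. -/
theorem exists_isQuotientMap_primeSpectrum [T2Space (piZeroSpec R)] {K : Type u}
    [TopologicalSpace K] [CompactSpace K] [T2Space K] (g : C(K, piZeroSpec R)) :
    ∃ (S : Type u) (_ : CommRing S) (_ : Algebra R S) (π : C(PrimeSpectrum S, K)),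
      Topology.IsQuotientMap π ∧
      ∀ q, g (π q) = _root_.ConnectedComponents.mk (PrimeSpectrum.comap (algebraMap R S) q) := by
  choose p hp using fun t => ConnectedComponents.surjective_coe (g t)
  let A : K → Type u := fun t => R ⧸ (p t).asIdeal
  let π : C(PrimeSpectrum (∀ t, A t), K) :=
    ⟨fun q => Ultrafilter.extend id (PrimeSpectrum.piUltrafilter q),
      (continuous_ultrafilter_extend id).comp PrimeSpectrum.continuous_piUltrafilter⟩
  have hπ : ∀ t, π (PrimeSpectrum.comap (Pi.evalRingHom A t) ⊥) = t := by
    intro t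
    change Ultrafilter.extend id (PrimeSpectrum.piUltrafilter _) = t
    rw [PrimeSpectrum.piUltrafilter_comap_eval]
    exact congrFun (ultrafilter_extend_extends id) t
  refine ⟨∀ t, A t, inferInstance, inferInstance, π,
    Topology.IsQuotientMap.of_surjective_continuous (fun t => ⟨_, hπ t⟩) π.continuous, ?_⟩
  -- both maps to `π₀ Spec R` are continuous and agree at the generic points of the factors
  refine congrFun (PrimeSpectrum.denseRange_comap_eval_bot.equalizer
    (g.continuous.comp π.continuous)
    (ConnectedComponents.continuous_coe.comp (PrimeSpectrum.continuous_comap _)) ?_)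
  funext t
  change g (π _) = _
  rw [hπ, ← hp t]
  refine congrArg _root_.ConnectedComponents.mk ?_
  rw [← PrimeSpectrum.comap_comp_apply]
  ext r
  exact Ideal.Quotient.eq_zero_iff_mem.symm

/-! ### Full faithfulness -/

/-- A transformation between relative Betti presheaves comes from a map of the underlying spaces
over `π₀ Spec R`. -/
theorem exists_over_hom_of_relativeBettiPresheaf_hom [IsWLocalRing R]
    [UCompactlyGeneratedSpace.{u} X.left] [T1Space Y.left]
    (η : (relativeBettiPresheaf R).obj X ⟶ (relativeBettiPresheaf R).obj Y) :
    ∃ f : X ⟶ Y, (relativeBettiPresheaf R).map f = η := by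
  have : WLocalSpace (PrimeSpectrum R) := IsWLocalRing.wLocalSpace_primeSpectrum
  choose m hm hmc using
    fun x : X.left => WLocalSpace.exists_isClosed_coe_eq (X := PrimeSpectrum R) (X.hom x)
  let f : X.left → Y.left := fun x =>
    evalSection (mapSection η (constSection (m x) x (hmc x).symm)) (IsLocalRing.closedPoint _)
  have hf : ∀ {S : Type u} [CommRing S] [Algebra R S]
      (φ : (specOver R).obj (.op (CommAlgCat.of R S)) ⟶ X) (p : PrimeSpectrum S),
      evalSection (mapSection η φ) p = f (evalSection φ p) := fun φ p =>
    evalSection_mapSection η φ p _ _ _ (WLocalSpace.specializes_of_isClosed (hm _)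
      ((hom_evalSection φ p).symm.trans (hmc _).symm)) rfl
  have hfc : Continuous f := by
    refine continuous_from_uCompactlyGeneratedSpace f fun K g => ?_
    obtain ⟨S, _, _, π, hπ, hπg⟩ := exists_isQuotientMap_primeSpectrum (R := R)
      ((⟨X.hom, X.hom.hom.continuous⟩ : C(X.left, piZeroSpec R)).comp g)
    rw [hπ.continuous_iff]
    refine (evalSection (mapSection η (sectionMk (g.comp π) hπg))).continuous.congr fun q => ?_
    exact hf _ q
  have hfY : ∀ x, Y.hom (f x) = X.hom x := fun x => by
    refine (hom_evalSection _ _).trans ?_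
    exact (hom_evalSection (constSection (m x) x (hmc x).symm) _).symm
  refine ⟨Over.homMk (TopCat.ofHom ⟨f, hfc⟩) (by ext x; exact hfY x), ?_⟩
  ext S φ
  exact section_ext fun p => (hf φ p).symm

/-- Maps over `π₀ Spec R` are determined by their values on constant sections over local rings. -/
theorem faithful_relativeBettiPresheaf (R : Type u) [CommRing R] :
    (relativeBettiPresheaf R).Faithful where
  map_injective {X Y} f g h := by
    refine Over.OverMorphism.ext (TopCat.hom_ext (ContinuousMap.ext fun x => ?_))
    obtain ⟨m, hm⟩ := ConnectedComponents.surjective_coe (X.hom x)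
    exact congrArg (fun η => evalSection (mapSection η (constSection m x hm.symm))
      (IsLocalRing.closedPoint _)) h

end RelativeBetti

theorem proposition4p8 (R : Type u) [CommRing R] [RelativeBetti.IsWLocalRing R] :
    (RelativeBetti.relativeBettiStack R).Full ∧ (RelativeBetti.relativeBettiStack R).Faithful := by
  have := RelativeBetti.faithful_relativeBettiPresheaf R
  let F := CostructuredArrow.toOver RelativeBetti.IsCGHaus.{u}.ι (RelativeBetti.piZeroSpec R)
  refine ⟨⟨fun {X Y} η => ?_⟩, ⟨fun {X Y} f g h => F.map_injective
    ((RelativeBetti.relativeBettiPresheaf R).map_injective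
      (congrArg (RelativeBetti.IsStack R).ι.map h))⟩⟩
  have : UCompactlyGeneratedSpace.{u} (F.obj X).left := X.left.property.1
  have : T2Space (F.obj Y).left := Y.left.property.2
  obtain ⟨f, hf⟩ := RelativeBetti.exists_over_hom_of_relativeBettiPresheaf_hom
    (X := F.obj X) (Y := F.obj Y) η.hom
  refine ⟨F.preimage f, ObjectProperty.hom_ext _ ?_⟩
  change (RelativeBetti.relativeBettiPresheaf R).map (F.map (F.preimage f)) = η.hom
  rw [F.map_preimage, hf]
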